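/- Let $Q>0$ and let $(f_j)_{j\ge 0}$ be an arbitrary probability distribution on the non-negative integers, with generating function $q(z)=\sum_{j\ge 0} f_j z^j$. Consider the random tree that evolves in continuous time as follows. At time $0$ the tree is a single living node (the root). Every living node has a lifetime that is exponentially distributed with rate $Q$; at the end of its life it becomes dead and produces $\nu$ new living nodes, where $P(\nu=j)=f_j$, each of which is connected to it by an outgoing line and evolves further like a root. All lifetimes and all offspring numbers are independent. An end-node at time $t$ is a (living or dead) node of the tree at time $t$ that has no outgoing lines; let $\mu(t,0)\in\{0,1,2,\dots\}\cup\{\infty\}$ be the number of end-nodes at time $t$. Then $\mu(t,0)$ has a limit in distribution $\tilde\mu_0$ with values in $\{0,1,2,\dots\}\cup\{\infty\}$ as $t\to\infty$, that is, $\lim_{t\to\infty}P(\mu(t,0)=n)=P(\tilde\mu_0=n)=:p^{(0)}_n$ for every finite $n\ge 0$, and its generating function $g_0(z)=\sum_{n=0}^{\infty}p^{(0)}_n z^n$ satisfies $$q[g_0(z)] = g_0(z)+(1-z)\,f_0\qquad\text{for all complex } z \text{ with } |z|\le 1 .$$ Moreover $g_0(0)=0$, i.e. $P(\tilde\mu_0=0)=0$: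 a stationary (infinitely old) tree almost surely has at least one end-node. -/

import Mathlib

open MeasureTheory ProbabilityTheory Filter Topology
open scoped ENNReal NNReal

namespace EvolvingTree

/-- The randomness driving the evolution: every potential node carries a lifetime (first component)
and a number of new nodes produced at its death (second component). Potential nodes are labelled by
lists of natural numbers: `[]` is the root and `i :: v` is the node with label `v` in the tree that
grows out of the `i`-th child of the root. -/
abbrev Realization : Type := List ℕ → ℝ × ℕ

/-- The lifetime of the node `u`. -/
def lifetime (ω : Realization) (u : List ℕ) : ℝ := (ω u).1

/-- The number `ν` of new living nodes produced by the node `u` at the end of its life. -/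
def offspring (ω : Realization) (u : List ℕ) : ℕ := (ω u).2

/-- The tree that grows out of the `i`-th child of the root. -/
def subtree (ω : Realization) (i : ℕ) : Realization := fun v => ω (i :: v)

/-- The node `u` is born at some time of the evolution. -/
def InTree : Realization → List ℕ → Prop
  | _, [] => True
  | ω, i :: v => i < offspring ω [] ∧ InTree (subtree ω i) v

/-- The birth time of the node `u`: the sum of the lifetimes of its proper ancestors. -/
noncomputable def birthTime : Realization → List ℕ → ℝ
  | _, [] => 0
  | ω, i :: v => lifetime ω [] + birthTime (subtree ω i) v

/-- The node `u` belongs to the tree (living or dead) at time `t`. -/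
def Present (ω : Realization) (t : ℝ) (u : List ℕ) : Prop :=
  InTree ω u ∧ birthTime ω u ≤ t

/-- The number of outgoing lines at time `t` of a node `u` present at time `t`: none as long as `u`
is living; one for each of the produced nodes as soon as `u` is dead. -/
noncomputable def outgoingLines (ω : Realization) (t : ℝ) (u : List ℕ) : ℕ :=
  if t < birthTime ω u + lifetime ω u then 0 else offspring ω u

/-- `μ(t, k)`: the number of nodes with exactly `k` outgoing lines at time `t`. -/
noncomputable def nodeCount (ω : Realization) (t : ℝ) (k : ℕ) : ℕ∞ :=
  {u : List ℕ | Present ω t u ∧ outgoingLines ω t u = k}.encard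

/-- `μ₀(t) = μ(t, 0)`: the number of end-nodes (living or dead) at time `t`. -/
noncomputable def endNodeCount (ω : Realization) (t : ℝ) : ℕ∞ := nodeCount ω t 0

/-- The law of the evolution started from a single living root: all lifetimes are exponentially
distributed with rate `Q`, all offspring numbers have distribution `f`, and all of these random
variables are independent. -/
noncomputable def law (Q : ℝ) (f : PMF ℕ) : Measure Realization :=
  Measure.infinitePi fun _ : List ℕ => (expMeasure Q).prod f.toMeasure

/-- The generating function `q(z) = ∑ fₙ zⁿ` of the offspring number. -/
noncomputable def offspringGenFun (f : PMF ℕ) (z : ℂ) : ℂ :=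
  ∑' n : ℕ, ((f n).toReal : ℂ) * z ^ n

/-- The generating function `∑ₙ P(X = n) zⁿ`, over finite `n`, of a random variable `X` with values
in `{0, 1, 2, …} ∪ {∞}` and law `π`. -/
noncomputable def genFun (π : Measure ℕ∞) (z : ℂ) : ℂ :=
  ∑' n : ℕ, (π.real {(n : ℕ∞)} : ℂ) * z ^ n

/-- `π` is the law of the limit in distribution of `μ₀(t)` as `t → ∞`, that is, of the number of
end-nodes of a stationary tree: `P(μ₀(t) = n) → π {n}` for every finite `n`, and `π` is a
probability measure on `{0, 1, 2, …} ∪ {∞}`, so that the mass missing from the finite values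
sits at `∞`. -/
structure IsStationaryEndNodeLaw (Q : ℝ) (f : PMF ℕ) (π : Measure ℕ∞) : Prop where
  isProbabilityMeasure : IsProbabilityMeasure π
  tendsto : ∀ n : ℕ, Tendsto (fun t : ℝ => law Q f {ω | endNodeCount ω t = n}) atTop
    (𝓝 (π {(n : ℕ∞)}))

end EvolvingTree

/-! An end-node at time `s` that later branches still has an end-node below it on its line of first
children, so almost surely the count never decreases in `t` and has a pathwise limit `limitCount`,
possibly `∞`. Explosion is allowed: only lines of first children must not accumulate, which
Borel–Cantelli gives (`ae_regular`). Convergence in law follows, and the limit is at least `1`, the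
count at time `0`. Cutting the tree at the root and letting `t → ∞` gives `Regular.limitCount_eq`:
the limit is `1` for a childless root, otherwise the sum of the limits of independent copies. With
the convention `z ^ ∞ = 0`, taking expectations of `z ^ limitCount` turns this into `g = f₀ z + ∑_{j
≥ 1} f_j g ^ j = q(g) - (1 - z) f₀`. -/

namespace EvolvingTree

/-! ### Lines of first children and monotonicity in time -/

/-- The set of end-nodes at time `t`. -/
def endNodes (ω : Realization) (t : ℝ) : Set (List ℕ) :=
  {u | Present ω t u ∧ outgoingLines ω t u = 0}

lemma endNodeCount_eq_encard (ω : Realization) (t : ℝ) :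
    endNodeCount ω t = (endNodes ω t).encard := rfl

/-- All lifetimes are positive, and along every line of first children the lifetimes do not
accumulate. Almost every realization has this property. -/
structure Regular (ω : Realization) : Prop where
  lifetime_pos : ∀ u, 0 < lifetime ω u
  frequently_lt : ∀ u, ∃ᶠ k in atTop, 1 < lifetime ω (u ++ List.replicate k 0)

lemma Regular.regular_subtree {ω : Realization} (h : Regular ω) (i : ℕ) : Regular (subtree ω i) :=
  ⟨fun u => h.lifetime_pos (i :: u), fun u => h.frequently_lt (i :: u)⟩

lemma birthTime_append_singleton (ω : Realization) (u : List ℕ) (i : ℕ) :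
    birthTime ω (u ++ [i]) = birthTime ω u + lifetime ω u := by
  induction u generalizing ω with
  | nil => simp [birthTime]
  | cons j v ih =>
    rw [List.cons_append, birthTime, ih, birthTime, add_assoc]
    rfl

lemma inTree_append_singleton (ω : Realization) (u : List ℕ) (i : ℕ) :
    InTree ω (u ++ [i]) ↔ InTree ω u ∧ i < offspring ω u := by
  induction u generalizing ω with
  | nil => simp [InTree]
  | cons j v ih =>
    rw [List.cons_append, InTree, ih, InTree, and_assoc]
    rfl

lemma append_replicate_succ (u : List ℕ) (k : ℕ) :
    u ++ List.replicate (k + 1) 0 = (u ++ List.replicate k 0) ++ [0] := by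
  rw [List.replicate_succ', List.append_assoc]

lemma birthTime_replicate_succ (ω : Realization) (u : List ℕ) (k : ℕ) :
    birthTime ω (u ++ List.replicate (k + 1) 0) =
      birthTime ω (u ++ List.replicate k 0) + lifetime ω (u ++ List.replicate k 0) := by
  rw [append_replicate_succ, birthTime_append_singleton]

lemma Regular.monotone_birthTime {ω : Realization} (h : Regular ω) (u : List ℕ) :
    Monotone fun k => birthTime ω (u ++ List.replicate k 0) :=
  monotone_nat_of_le_succ fun k => by
    rw [birthTime_replicate_succ]
    linarith [h.lifetime_pos (u ++ List.replicate k 0)]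

lemma Regular.exists_lt_birthTime {ω : Realization} (h : Regular ω) (u : List ℕ) (t : ℝ) :
    ∃ k, t < birthTime ω (u ++ List.replicate k 0) := by
  -- Each lifetime exceeding `1` adds at least `1` to the birth time, and such lifetimes recur
  -- beyond every generation.
  have key : ∀ N : ℕ, ∃ k, birthTime ω u + N ≤ birthTime ω (u ++ List.replicate k 0) := by
    intro N
    induction N with
    | zero => exact ⟨0, by simp⟩
    | succ N ih =>
      obtain ⟨k, hk⟩ := ih
      obtain ⟨m, hkm, hm⟩ := (frequently_atTop.1 (h.frequently_lt u)) k
      refine ⟨m + 1, ?_⟩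
      have := h.monotone_birthTime u hkm
      rw [birthTime_replicate_succ]
      push_cast
      simp only at this
      linarith
  obtain ⟨N, hN⟩ := exists_nat_gt (t - birthTime ω u)
  obtain ⟨k, hk⟩ := key N
  exact ⟨k, by linarith⟩

lemma outgoingLines_ne_zero_iff {ω : Realization} {t : ℝ} {u : List ℕ} :
    outgoingLines ω t u ≠ 0 ↔ birthTime ω u + lifetime ω u ≤ t ∧ 0 < offspring ω u := by
  unfold outgoingLines
  split_ifs with hlt
  · simp [hlt]
  · simp [not_lt.1 hlt, Nat.pos_iff_ne_zero]

/-- A node that is present has, at the end of its line of first children, an end-node. -/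
lemma Regular.exists_mem_endNodes {ω : Realization} (h : Regular ω) {t : ℝ} {u : List ℕ}
    (hu : Present ω t u) : ∃ k, u ++ List.replicate k 0 ∈ endNodes ω t := by
  -- Without an end-node the whole infinite line would be born by time `t`.
  by_contra! hno
  have key : ∀ k, Present ω t (u ++ List.replicate k 0) := by
    intro k
    induction k with
    | zero => simpa using hu
    | succ k ih =>
      have hout : outgoingLines ω t (u ++ List.replicate k 0) ≠ 0 := fun h0 => hno k ⟨ih, h0⟩
      rw [outgoingLines_ne_zero_iff] at hout
      refine ⟨?_, ?_⟩
      · rw [append_replicate_succ, inTree_append_singleton]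
        exact ⟨ih.1, hout.2⟩
      · rw [birthTime_replicate_succ]
        exact hout.1
  obtain ⟨k, hk⟩ := h.exists_lt_birthTime u t
  exact absurd (key k).2 (not_le.2 hk)

/-- The first child of `u` is born no later than its further descendants, so `u` already has an
outgoing line. This makes the map between end-node sets in `Regular.monotone_endNodeCount`
injective. -/
lemma Regular.not_mem_endNodes {ω : Realization} (h : Regular ω) {t : ℝ} {u : List ℕ} {m : ℕ}
    (hm : Present ω t (u ++ List.replicate (m + 1) 0)) : u ∉ endNodes ω t := by
  rintro ⟨-, h0⟩
  have htree : InTree ω (u ++ List.replicate 1 0) := by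
    have hall : ∀ m, InTree ω (u ++ List.replicate (m + 1) 0) →
        InTree ω (u ++ List.replicate 1 0) := by
      intro m
      induction m with
      | zero => exact id
      | succ m ih =>
        intro hm
        rw [append_replicate_succ, inTree_append_singleton] at hm
        exact ih hm.1
    exact hall m hm.1
  have hbirth : birthTime ω (u ++ List.replicate 1 0) ≤ t :=
    (h.monotone_birthTime u (Nat.succ_le_succ m.zero_le)).trans hm.2
  rw [List.replicate_one, inTree_append_singleton] at htree
  rw [List.replicate_one, birthTime_append_singleton] at hbirth
  exact outgoingLines_ne_zero_iff.2 ⟨hbirth, htree.2⟩ h0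

lemma append_replicate_eq {u v : List ℕ} {k l : ℕ} (hkl : k ≤ l)
    (h : u ++ List.replicate k 0 = v ++ List.replicate l 0) :
    u = v ++ List.replicate (l - k) 0 := by
  have hl : l = (l - k) + k := by omega
  rw [hl, List.replicate_add, ← List.append_assoc] at h
  simpa using List.append_cancel_right h

/-- The number of end-nodes is nondecreasing in time. -/
lemma Regular.monotone_endNodeCount {ω : Realization} (h : Regular ω) :
    Monotone (endNodeCount ω) := by
  intro s t hst
  have hex : ∀ u : endNodes ω s, ∃ k, u.1 ++ List.replicate k 0 ∈ endNodes ω t := fun u =>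
    h.exists_mem_endNodes ⟨u.2.1.1, u.2.1.2.trans hst⟩
  choose k hk using hex
  let F : endNodes ω s → endNodes ω t := fun u => ⟨u.1 ++ List.replicate (k u) 0, hk u⟩
  -- If the images agree, `u` is `v` followed by zeros; were it a proper descendant, `v` would not
  -- be an end-node at time `s`.
  have aux : ∀ u v : endNodes ω s, k u ≤ k v → F u = F v → u = v := by
    intro u v huv hF
    have heq := append_replicate_eq huv (congrArg Subtype.val hF)
    rcases Nat.eq_zero_or_pos (k v - k u) with h0 | h0
    · exact Subtype.ext (by simpa [h0] using heq)
    · obtain ⟨m, hm⟩ := Nat.exists_eq_add_of_le' h0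
      have hu := u.2.1
      rw [heq, hm] at hu
      exact absurd v.2 (h.not_mem_endNodes hu)
  have hinj : Function.Injective F := fun u v hF =>
    (le_total (k u) (k v)).elim (fun huv => aux u v huv hF) fun huv => (aux v u huv hF.symm).symm
  simpa [endNodeCount_eq_encard] using! ENat.card_le_card_of_injective hinj

/-! ### Decomposition at the root -/

lemma nil_mem_endNodes {ω : Realization} {t : ℝ} :
    [] ∈ endNodes ω t ↔ 0 ≤ t ∧ (t < lifetime ω [] ∨ offspring ω [] = 0) := by
  simp only [endNodes, Present, InTree, birthTime, outgoingLines, Set.mem_ofPred_eq, true_and,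
    zero_add]
  split_ifs with hlt <;> simp [hlt]

lemma cons_mem_endNodes {ω : Realization} {t : ℝ} {i : ℕ} {v : List ℕ} :
    i :: v ∈ endNodes ω t ↔
      i < offspring ω [] ∧ v ∈ endNodes (subtree ω i) (t - lifetime ω []) := by
  have h1 : birthTime ω (i :: v) ≤ t ↔ birthTime (subtree ω i) v ≤ t - lifetime ω [] := by
    rw [birthTime, le_sub_iff_add_le']
  have h2 : outgoingLines ω t (i :: v) = outgoingLines (subtree ω i) (t - lifetime ω []) v := by
    have : t < birthTime ω (i :: v) + lifetime ω (i :: v) ↔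
        t - lifetime ω [] < birthTime (subtree ω i) v + lifetime (subtree ω i) v := by
      rw [birthTime, sub_lt_iff_lt_add', ← add_assoc]
      rfl
    simp only [outgoingLines, this]
    rfl
  simp only [endNodes, Present, InTree, Set.mem_ofPred_eq, h1, h2, and_assoc]

lemma Regular.endNodeCount_zero {ω : Realization} (h : Regular ω) : endNodeCount ω 0 = 1 := by
  have : endNodes ω 0 = {[]} := by
    ext u
    cases u with
    | nil => simp [nil_mem_endNodes, h.lifetime_pos]
    | cons i v =>
      simp only [cons_mem_endNodes, Set.mem_singleton_iff, reduceCtorEq, iff_false]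
      rintro ⟨-, hv⟩
      have hpos : ∀ (v : List ℕ) (ω : Realization), Regular ω → 0 ≤ birthTime ω v := by
        intro v
        induction v with
        | nil => intros; exact le_rfl
        | cons j w ih =>
          intro ω hω
          exact add_nonneg (hω.lifetime_pos _).le (ih _ (hω.regular_subtree j))
      have := hv.1.2
      linarith [hpos v _ (h.regular_subtree i), h.lifetime_pos []]
  rw [endNodeCount_eq_encard, this, Set.encard_singleton]

/-- The number of end-nodes after the death of the root. -/
lemma endNodeCount_of_lifetime_le {ω : Realization} {t : ℝ} (ht : 0 ≤ t)
    (h : lifetime ω [] ≤ t) :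
    endNodeCount ω t = if offspring ω [] = 0 then 1 else
      ∑ i : Fin (offspring ω []), endNodeCount (subtree ω i) (t - lifetime ω []) := by
  split_ifs with h0
  · have : endNodes ω t = {[]} := by
      ext u
      cases u with
      | nil => simp [nil_mem_endNodes, ht, h0]
      | cons i v => simp [cons_mem_endNodes, h0]
    rw [endNodeCount_eq_encard, this, Set.encard_singleton]
  · have : endNodes ω t = ⋃ i : Fin (offspring ω []),
        List.cons (i : ℕ) '' endNodes (subtree ω i) (t - lifetime ω []) := by
      ext u
      cases u with
      | nil => simp [nil_mem_endNodes, h0, h]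
      | cons i v =>
        simp only [cons_mem_endNodes, Set.mem_iUnion, Set.mem_image, List.cons.injEq]
        constructor
        · rintro ⟨hi, hv⟩
          exact ⟨⟨i, hi⟩, v, hv, rfl, rfl⟩
        · rintro ⟨j, w, hw, rfl, rfl⟩
          exact ⟨j.2, hw⟩
    rw [endNodeCount_eq_encard, this, Set.encard_iUnion_of_finite, finsum_eq_sum_of_fintype]
    · refine Finset.sum_congr rfl fun i _ => ?_
      rw [endNodeCount_eq_encard, (List.cons_injective (a := (i : ℕ))).encard_image]
    · intro i j hij
      refine Set.disjoint_left.2 ?_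
      rintro _ ⟨v, -, rfl⟩ ⟨w, -, hw⟩
      exact hij (Fin.ext (List.cons.inj hw).1.symm)

/-! ### The pathwise limit -/

/-- The number of end-nodes of the infinitely old tree. -/
noncomputable def limitCount (ω : Realization) : ℕ∞ := ⨆ n : ℕ, endNodeCount ω n

/-- By monotonicity the supremum over integer times is also the limit along real times; the
countable supremum keeps `limitCount` measurable. -/
lemma Regular.tendsto_endNodeCount {ω : Realization} (h : Regular ω) :
    Tendsto (endNodeCount ω) atTop (𝓝 (limitCount ω)) := by
  have h1 := tendsto_atTop_iSup h.monotone_endNodeCount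
  have h2 : Tendsto (fun n : ℕ => endNodeCount ω n) atTop (𝓝 (limitCount ω)) :=
    tendsto_atTop_iSup fun m n hmn => h.monotone_endNodeCount (Nat.cast_le.2 hmn)
  rwa [tendsto_nhds_unique (h1.comp tendsto_natCast_atTop_atTop) h2] at h1

lemma Regular.one_le_limitCount {ω : Realization} (h : Regular ω) : 1 ≤ limitCount ω := by
  rw [← h.endNodeCount_zero]
  exact le_iSup_of_le 0 (by simp)

lemma Regular.limitCount_eq {ω : Realization} (h : Regular ω) :
    limitCount ω = if offspring ω [] = 0 then 1 else
      ∑ i : Fin (offspring ω []), limitCount (subtree ω i) := by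
  refine tendsto_nhds_unique (h.tendsto_endNodeCount.congr' ?_) ?_
    (f := fun t => if offspring ω [] = 0 then 1 else
      ∑ i : Fin (offspring ω []), endNodeCount (subtree ω i) (t - lifetime ω []))
  · filter_upwards [eventually_ge_atTop 0, eventually_ge_atTop (lifetime ω [])] with t h0 h1
      using endNodeCount_of_lifetime_le h0 h1
  · split_ifs
    · exact tendsto_const_nhds
    · exact tendsto_finsetSum _ fun i _ => (h.regular_subtree i).tendsto_endNodeCount.comp
        (tendsto_atTop_add_const_right _ _ tendsto_id)

/-- Eventually in time, the number of end-nodes is `n` if and only if its limit is `n`. -/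
lemma Regular.eventually_endNodeCount_eq_iff {ω : Realization} (h : Regular ω) (n : ℕ) :
    ∀ᶠ t in atTop, endNodeCount ω t = n ↔ limitCount ω = n := by
  by_cases hn : limitCount ω = n
  · have := h.tendsto_endNodeCount
    -- Finite points of `ℕ∞` are isolated, so convergence to `n` means eventual equality.
    rw [hn, ENat.nhds_natCast, tendsto_pure] at this
    filter_upwards [this] with t ht
    simp [ht, hn]
  · filter_upwards [h.tendsto_endNodeCount.eventually_ne hn] with t ht
    simp [ht, hn]

instance : BorelSpace ℕ∞ := ⟨borel_eq_top_of_countable.symm⟩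

/-! ### Measurability of the counts -/

section Measurability

lemma measurable_lifetime (u : List ℕ) : Measurable fun ω : Realization => lifetime ω u :=
  measurable_fst.comp (measurable_pi_apply u)

lemma measurable_offspring (u : List ℕ) : Measurable fun ω : Realization => offspring ω u :=
  measurable_snd.comp (measurable_pi_apply u)

lemma measurable_subtree (i : ℕ) : Measurable fun ω : Realization => subtree ω i :=
  measurable_pi_lambda _ fun v => measurable_pi_apply (i :: v)

lemma measurable_birthTime (u : List ℕ) : Measurable fun ω : Realization => birthTime ω u := by
  induction u with
  | nil => exact measurable_const
  | cons i v ih => exact (measurable_lifetime []).add (ih.comp (measurable_subtree i))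

lemma measurableSet_inTree (u : List ℕ) : MeasurableSet {ω : Realization | InTree ω u} := by
  induction u with
  | nil => exact MeasurableSet.univ
  | cons i v ih =>
    exact (measurableSet_lt measurable_const (measurable_offspring [])).inter
      (measurable_subtree i ih)

lemma measurable_endNodeCount (t : ℝ) : Measurable fun ω : Realization => endNodeCount ω t := by
  refine measurable_encard.comp (measurable_set_iff.2 fun u => measurable_mem.2 ?_)
  have hout : Measurable fun ω : Realization => outgoingLines ω t u :=
    Measurable.ite (measurableSet_lt measurable_const
      ((measurable_birthTime u).add (measurable_lifetime u))) measurable_const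
      (measurable_offspring u)
  exact ((measurableSet_inTree u).inter
    (measurableSet_le (measurable_birthTime u) measurable_const)).inter
    (hout (measurableSet_singleton 0))

lemma measurable_limitCount : Measurable limitCount :=
  Measurable.iSup fun n : ℕ => measurable_endNodeCount n

end Measurability

/-! ### Almost sure regularity and the branching property -/

section Law

variable {Q : ℝ} (f : PMF ℕ)

lemma isProbabilityMeasure_node (hQ : 0 < Q) :
    IsProbabilityMeasure ((expMeasure Q).prod f.toMeasure) :=
  have := isProbabilityMeasure_expMeasure hQ
  inferInstance

lemma isProbabilityMeasure_law (hQ : 0 < Q) : IsProbabilityMeasure (law Q f) :=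
  have := isProbabilityMeasure_node f hQ
  inferInstanceAs (IsProbabilityMeasure (Measure.infinitePi _))

lemma map_eval_law (hQ : 0 < Q) (u : List ℕ) :
    (law Q f).map (fun ω => ω u) = (expMeasure Q).prod f.toMeasure :=
  have := isProbabilityMeasure_node f hQ
  Measure.infinitePi_map_eval (fun _ : List ℕ => (expMeasure Q).prod f.toMeasure) u

lemma map_lifetime_law (hQ : 0 < Q) (u : List ℕ) :
    (law Q f).map (fun ω => lifetime ω u) = expMeasure Q := by
  have := isProbabilityMeasure_expMeasure hQ
  have h := Measure.map_map (μ := law Q f) measurable_fst (measurable_pi_apply u)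
  rw [map_eval_law f hQ, Measure.map_fst_prod, measure_univ, one_smul] at h
  exact h.symm

lemma iIndepFun_eval_law (hQ : 0 < Q) :
    iIndepFun (fun (u : List ℕ) (ω : Realization) => ω u) (law Q f) :=
  have := isProbabilityMeasure_node f hQ
  iIndepFun_infinitePi (P := fun _ : List ℕ => (expMeasure Q).prod f.toMeasure)
    (X := fun _ x => x) fun _ => measurable_id

lemma ae_lifetime_pos (hQ : 0 < Q) (u : List ℕ) : ∀ᵐ ω ∂law Q f, 0 < lifetime ω u := by
  have := isProbabilityMeasure_expMeasure hQ
  have h : ∀ᵐ x ∂expMeasure Q, 0 < x := by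
    have h0 : expMeasure Q (Set.Iic 0) = 0 := by
      rw [← ofReal_cdf, cdf_expMeasure_eq hQ]
      simp
    rw [ae_iff]
    simpa [Set.Iic] using h0
  rw [← map_lifetime_law f hQ u] at h
  exact ae_of_ae_map (measurable_lifetime u).aemeasurable h

lemma expMeasure_Ioi_ne_zero (hQ : 0 < Q) {x : ℝ} (hx : 0 ≤ x) :
    expMeasure Q (Set.Ioi x) ≠ 0 := by
  have := isProbabilityMeasure_expMeasure hQ
  rw [← Set.compl_Iic, prob_compl_eq_one_sub measurableSet_Iic, ← ofReal_cdf,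
    cdf_expMeasure_eq hQ, if_pos hx]
  refine (tsub_pos_of_lt ?_).ne'
  rw [← ENNReal.ofReal_one, ENNReal.ofReal_lt_ofReal_iff one_pos]
  linarith [Real.exp_pos (-(Q * x))]

/-- Second Borel–Cantelli lemma: the events are independent with the same positive probability. -/
lemma ae_frequently_lt (hQ : 0 < Q) (u : List ℕ) :
    ∀ᵐ ω ∂law Q f, ∃ᶠ k in atTop, 1 < lifetime ω (u ++ List.replicate k 0) := by
  have := isProbabilityMeasure_law f hQ
  let s : ℕ → Set Realization := fun k => {ω | 1 < lifetime ω (u ++ List.replicate k 0)}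
  have hinj : Function.Injective fun k : ℕ => u ++ List.replicate k 0 := fun k l hkl => by
    simpa using congrArg List.length hkl
  have hind : iIndepFun (fun k ω => lifetime ω (u ++ List.replicate k 0)) (law Q f) :=
    ((iIndepFun_eval_law f hQ).precomp hinj).comp (fun _ => Prod.fst) fun _ => measurable_fst
  have hs : ∀ k, MeasurableSet (s k) := fun k =>
    measurableSet_lt measurable_const (measurable_lifetime _)
  have hset : iIndepSet s (law Q f) := by
    rw [iIndepSet_iff_meas_biInter hs]
    intro S
    exact hind.measure_inter_preimage_eq_mul S (sets := fun _ => Set.Ioi 1)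
      fun _ _ => measurableSet_Ioi
  have hmeas : ∀ k, law Q f (s k) = expMeasure Q (Set.Ioi 1) := fun k => by
    rw [← map_lifetime_law f hQ (u ++ List.replicate k 0),
      Measure.map_apply (measurable_lifetime _) measurableSet_Ioi]
    rfl
  have hone := measure_limsup_eq_one hs hset (by
    simp_rw [hmeas]
    exact ENNReal.tsum_const_eq_top_of_ne_zero (expMeasure_Ioi_ne_zero hQ zero_le_one))
  have hae := (prob_compl_eq_zero_iff (MeasurableSet.measurableSet_limsup hs)).2 hone
  filter_upwards [compl_mem_ae_iff.2 hae] with ω hω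
  rw [compl_compl, mem_limsup_iff_frequently_mem] at hω
  exact hω

lemma ae_regular (hQ : 0 < Q) : ∀ᵐ ω ∂law Q f, Regular ω := by
  filter_upwards [ae_all_iff.2 (ae_lifetime_pos f hQ), ae_all_iff.2 (ae_frequently_lt f hQ)]
    with ω h1 h2 using ⟨h1, h2⟩

/-- The trees growing out of the children of the root are independent copies of the tree. -/
lemma map_subtree_law (hQ : 0 < Q) :
    (law Q f).map subtree = Measure.infinitePi fun _ : ℕ => law Q f := by
  have := isProbabilityMeasure_node f hQ
  have hinj : Function.Injective fun p : ℕ × List ℕ => p.1 :: p.2 := fun p q h => by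
    simpa [Prod.ext_iff] using h
  have h1 := Measure.map_infinitePi_infinitePi_of_inj hinj
    (P := fun _ : List ℕ => (expMeasure Q).prod f.toMeasure)
  have h2 := Measure.infinitePi_map_curry
    (fun (_ : ℕ) (_ : List ℕ) => (expMeasure Q).prod f.toMeasure)
  rw [← h1, Measure.map_map (MeasurableEquiv.measurable _) (by fun_prop)] at h2
  exact h2

lemma measurable_subtrees : Measurable (subtree : Realization → ℕ → Realization) :=
  measurable_pi_lambda _ measurable_subtree

/-- The root is independent of the trees growing out of its children. -/
lemma indepFun_nil_subtree (hQ : 0 < Q) :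
    IndepFun (fun ω : Realization => ω []) subtree (law Q f) := by
  -- The coordinates at `[]` and at all other labels generate independent σ-algebras; `subtree` uses
  -- only the latter.
  have h := indep_iSup_of_disjoint (fun u => (measurable_pi_apply u).comap_le)
    ((iIndepFun_iff_iIndep _ _ _).1 (iIndepFun_eval_law f hQ)) (S := {[]}) (T := {[]}ᶜ)
    disjoint_compl_right
  rw [IndepFun_iff_Indep]
  refine indep_of_indep_of_le_left (indep_of_indep_of_le_right h ?_) ?_
  · rw [← measurable_iff_comap_le]
    refine @measurable_pi_lambda _ _ _ (_) _ _ fun i => @measurable_pi_lambda _ _ _ (_) _ _ fun v =>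
      measurable_iff_comap_le.2 ?_
    exact le_iSup₂_of_le (i :: v) (by simp) le_rfl
  · exact le_iSup₂_of_le [] rfl le_rfl

lemma map_nil_subtree_law (hQ : 0 < Q) :
    (law Q f).map (fun ω => (ω [], subtree ω)) =
      ((expMeasure Q).prod f.toMeasure).prod (Measure.infinitePi fun _ : ℕ => law Q f) := by
  have := isProbabilityMeasure_law f hQ
  rw [(indepFun_iff_map_prod_eq_prod_map_map (measurable_pi_apply _).aemeasurable
    measurable_subtrees.aemeasurable).1 (indepFun_nil_subtree f hQ), map_eval_law f hQ,
    map_subtree_law f hQ]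

end Law

/-! ### Generating functions as expectations -/

/-- The function `n ↦ z ^ n`, extended by `0` at `∞`. -/
noncomputable def powExt (z : ℂ) (n : ℕ∞) : ℂ := if n = ⊤ then 0 else z ^ n.toNat

@[simp] lemma powExt_top (z : ℂ) : powExt z ⊤ = 0 := if_pos rfl

@[simp] lemma powExt_coe (z : ℂ) (n : ℕ) : powExt z n = z ^ n := by simp [powExt]

@[simp] lemma powExt_one (z : ℂ) : powExt z 1 = z := by simpa using powExt_coe z 1

@[simp] lemma powExt_zero (z : ℂ) : powExt z 0 = 1 := by simpa using powExt_coe z 0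

lemma powExt_add (z : ℂ) (m n : ℕ∞) : powExt z (m + n) = powExt z m * powExt z n := by
  induction m with
  | top => simp
  | coe m =>
    induction n with
    | top => simp
    | coe n => rw [← Nat.cast_add, powExt_coe, powExt_coe, powExt_coe, pow_add]

lemma powExt_sum (z : ℂ) {ι : Type*} (s : Finset ι) (g : ι → ℕ∞) :
    powExt z (∑ i ∈ s, g i) = ∏ i ∈ s, powExt z (g i) := by
  classical
  induction s using Finset.induction_on with
  | empty => simp
  | insert a s ha ih => rw [Finset.sum_insert ha, Finset.prod_insert ha, powExt_add, ih]

lemma norm_powExt_le {z : ℂ} (hz : ‖z‖ ≤ 1) (n : ℕ∞) : ‖powExt z n‖ ≤ 1 := by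
  induction n with
  | top => simp
  | coe n => simpa using pow_le_one₀ (norm_nonneg z) hz

lemma measurable_powExt (z : ℂ) : Measurable (powExt z) := measurable_of_countable _

lemma genFun_eq_integral (π : Measure ℕ∞) [IsFiniteMeasure π] {z : ℂ} (hz : ‖z‖ ≤ 1) :
    genFun π z = ∫ n, powExt z n ∂π := by
  have hint : Integrable (powExt z) π :=
    Integrable.of_bound (measurable_powExt z).aestronglyMeasurable 1
      (ae_of_all _ (norm_powExt_le hz))
  rw [integral_countable hint, genFun,
    ← (Nat.cast_injective : Function.Injective ((↑) : ℕ → ℕ∞)).tsum_eq]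
  · simp
  · intro n hn
    induction n with
    | top => simp at hn
    | coe n => exact ⟨n, rfl⟩

/-! ### The functional equation -/

section GeneratingFunction

variable {Q : ℝ} (f : PMF ℕ)

/-- Conditioning on the number of children of the root. -/
lemma integral_powExt_limitCount (hQ : 0 < Q) {z : ℂ} (hz : ‖z‖ ≤ 1) :
    ∫ ω, powExt z (limitCount ω) ∂law Q f =
      ∫ j, (if j = 0 then z else (∫ ω, powExt z (limitCount ω) ∂law Q f) ^ j) ∂f.toMeasure := by
  have := isProbabilityMeasure_law f hQ
  have := isProbabilityMeasure_expMeasure hQ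
  -- `z ^ limitCount` as a function of the root's offspring number and the subtrees. For `j = 0` the
  -- root itself is an end-node, hence `z` and not the empty product `1`.
  let Z : ℕ → (ℕ → Realization) → ℂ := fun j η =>
    if j = 0 then z else ∏ i : Fin j, powExt z (limitCount (η i))
  have hφ : Measurable fun ω => powExt z (limitCount ω) :=
    (measurable_powExt z).comp measurable_limitCount
  have hZ : ∀ j, Measurable (Z j) := fun j => by
    by_cases hj : j = 0
    · simp only [Z, if_pos hj, measurable_const]
    · simp only [Z, if_neg hj]
      exact Finset.measurable_fun_prod _ fun i _ => hφ.comp (measurable_pi_apply _)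
  have hZle : ∀ j η, ‖Z j η‖ ≤ 1 := fun j η => by
    by_cases hj : j = 0
    · simpa only [Z, if_pos hj] using hz
    · simp only [Z, if_neg hj, norm_prod]
      exact Finset.prod_le_one (fun _ _ => norm_nonneg _) fun i _ => norm_powExt_le hz _
  have hZm : Measurable fun p : ℕ × (ℕ → Realization) => Z p.1 p.2 :=
    measurable_from_prod_countable_right hZ
  have hZm' : Measurable fun p : (ℝ × ℕ) × (ℕ → Realization) => Z p.1.2 p.2 :=
    hZm.comp ((measurable_snd.comp measurable_fst).prodMk measurable_snd)
  have hZint : ∀ j, ∫ η, Z j η ∂Measure.infinitePi (fun _ : ℕ => law Q f) =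
      if j = 0 then z else (∫ ω, powExt z (limitCount ω) ∂law Q f) ^ j := fun j => by
    by_cases hj : j = 0
    · simp [Z, hj]
    · simp only [Z, if_neg hj]
      have hind : iIndepFun (fun (i : Fin j) (η : ℕ → Realization) =>
          powExt z (limitCount (η i))) (Measure.infinitePi fun _ : ℕ => law Q f) :=
        (iIndepFun_infinitePi (P := fun _ : ℕ => law Q f)
          (X := fun _ ω => powExt z (limitCount ω)) fun _ => hφ).precomp Fin.val_injective
      rw [hind.integral_fun_prod_eq_prod_integral fun i =>
        (hφ.comp (measurable_pi_apply _)).aestronglyMeasurable]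
      have heval : ∀ i : ℕ, ∫ η, powExt z (limitCount (η i))
          ∂Measure.infinitePi (fun _ : ℕ => law Q f) =
            ∫ ω, powExt z (limitCount ω) ∂law Q f := fun i => by
        rw [← integral_map (φ := fun η : ℕ → Realization => η i)
          (f := fun ω => powExt z (limitCount ω)) (measurable_pi_apply i).aemeasurable
          hφ.aestronglyMeasurable, Measure.infinitePi_map_eval]
      simp [heval]
  have hrec : ∀ᵐ ω ∂law Q f, powExt z (limitCount ω) = Z (ω []).2 (subtree ω) := by
    filter_upwards [ae_regular f hQ] with ω hω
    change _ = if offspring ω [] = 0 then z else _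
    rw [hω.limitCount_eq]
    split_ifs
    · exact powExt_one z
    · exact powExt_sum z _ _
  refine (integral_congr_ae hrec).trans ?_
  rw [← integral_map (φ := fun ω : Realization => (ω [], subtree ω))
    (f := fun p : (ℝ × ℕ) × (ℕ → Realization) => Z p.1.2 p.2)
    ((measurable_pi_apply _).prodMk measurable_subtrees).aemeasurable hZm'.aestronglyMeasurable,
    map_nil_subtree_law f hQ, integral_prod _ (Integrable.of_bound hZm'.aestronglyMeasurable 1
      (ae_of_all _ fun p => hZle _ _))]
  simp only [hZint]
  rw [← integral_map (φ := Prod.snd) (f := fun j : ℕ =>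
      if j = 0 then z else (∫ ω, powExt z (limitCount ω) ∂law Q f) ^ j)
    measurable_snd.aemeasurable (measurable_of_countable _).aestronglyMeasurable,
    Measure.map_snd_prod, measure_univ, one_smul]

lemma summable_toReal_mul_pow {g : ℂ} (hg : ‖g‖ ≤ 1) :
    Summable fun n : ℕ => ((f n).toReal : ℂ) * g ^ n := by
  refine Summable.of_norm_bounded (g := fun n => (f n).toReal)
    (ENNReal.summable_toReal (by simp [f.tsum_coe])) fun n => ?_
  rw [norm_mul, norm_pow, Complex.norm_real, Real.norm_of_nonneg ENNReal.toReal_nonneg]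
  exact mul_le_of_le_one_right ENNReal.toReal_nonneg (pow_le_one₀ (norm_nonneg g) hg)

/-- If `q(g) = ∑ fₙ gⁿ`, then replacing the constant term `f₀` by `f₀ z` gives
`q(g) - (1 - z) f₀`. -/
lemma integral_ite_pow {z g : ℂ} (hz : ‖z‖ ≤ 1) (hg : ‖g‖ ≤ 1) :
    ∫ j, (if j = 0 then z else g ^ j) ∂f.toMeasure =
      offspringGenFun f g - (1 - z) * ((f 0).toReal : ℂ) := by
  have hb : ∀ j : ℕ, ‖if j = 0 then z else g ^ j‖ ≤ 1 := fun j => by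
    split_ifs
    · exact hz
    · simpa using pow_le_one₀ (norm_nonneg g) hg
  rw [PMF.integral_eq_tsum _ _ (Integrable.of_bound
    (measurable_of_countable _).aestronglyMeasurable 1 (ae_of_all _ hb)), offspringGenFun,
    ← tsum_ite_eq (0 : ℕ) fun _ => (1 - z) * ((f 0).toReal : ℂ),
    ← (summable_toReal_mul_pow f hg).tsum_sub (hasSum_ite_eq _ _).summable]
  refine tsum_congr fun j => ?_
  by_cases hj : j = 0
  · subst hj
    simp only [if_true, pow_zero, Complex.real_smul]
    ring
  · simp [hj]

end GeneratingFunction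

end EvolvingTree

open EvolvingTree in
theorem mainTheorem4 (Q : ℝ) (hQ : 0 < Q) (f : PMF ℕ) :
    ∃ π : Measure ℕ∞, EvolvingTree.IsStationaryEndNodeLaw Q f π ∧
      (∀ z : ℂ, ‖z‖ ≤ 1 →
        EvolvingTree.offspringGenFun f (EvolvingTree.genFun π z) =
          EvolvingTree.genFun π z + (1 - z) * ((f 0).toReal : ℂ)) ∧
      EvolvingTree.genFun π 0 = 0 ∧
      π {0} = 0 := by
  have := isProbabilityMeasure_law f hQ
  have hπ : IsProbabilityMeasure ((law Q f).map limitCount) :=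
    Measure.isProbabilityMeasure_map measurable_limitCount.aemeasurable
  have hzero : (law Q f).map limitCount {0} = 0 := by
    rw [Measure.map_apply measurable_limitCount (measurableSet_singleton 0),
      measure_eq_zero_iff_ae_notMem]
    filter_upwards [ae_regular f hQ] with ω hω h0
    exact absurd (hω.one_le_limitCount.trans_eq h0) (by simp)
  refine ⟨(law Q f).map limitCount, ⟨hπ, fun n => ?_⟩, fun z hz => ?_, ?_, hzero⟩
  · rw [Measure.map_apply measurable_limitCount (measurableSet_singleton _)]
    -- Almost surely the indicators of the events eventually agree with that of the limit event, so
    -- the probabilities converge.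
    refine tendsto_measure_of_ae_tendsto_indicator_of_isFiniteMeasure atTop
      (measurable_limitCount (measurableSet_singleton _))
      (fun t => measurable_endNodeCount t (measurableSet_singleton _)) ?_
    filter_upwards [ae_regular f hQ] with ω hω
    exact hω.eventually_endNodeCount_eq_iff n
  · have hgen : genFun ((law Q f).map limitCount) z = ∫ ω, powExt z (limitCount ω) ∂law Q f := by
      rw [genFun_eq_integral _ hz, integral_map measurable_limitCount.aemeasurable
        (measurable_powExt z).aestronglyMeasurable]
    have hle : ‖∫ ω, powExt z (limitCount ω) ∂law Q f‖ ≤ 1 := by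
      simpa using norm_integral_le_of_norm_le_const (μ := law Q f)
        (ae_of_all _ fun ω => norm_powExt_le hz (limitCount ω))
    have hrec := integral_powExt_limitCount f hQ hz
    rw [integral_ite_pow f hz hle] at hrec
    rw [hgen]
    linear_combination -hrec
  · rw [genFun, tsum_eq_single 0 fun n hn => by simp [hn]]
    simp [measureReal_def, hzero]
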